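/- All rings are commutative with $1$. Let $R$ be a Noetherian ring with total quotient ring $Q$ (the localization of $R$ at the set of all its non-zerodivisors). An $R$-module $L$ is called torsion-free if every non-zerodivisor of $R$ acts injectively on $L$; an $R$-module $N$ is called h-divisible if there is a surjective $R$-linear map $F \to N$ from a free $Q$-module $F$. For an $R$-module $M$, regard $\operatorname{Hom}_R(Q,M)$ as a $Q$-module via $(af)(x) = f(ax)$. Let $M$ be an $R$-module. The following are equivalent: (a) $M$ is an injective $R$-module. (b) $\operatorname{Hom}_R(Q,M)$ is an injective $Q$-module, and $\operatorname{Hom}_R(L,M)$ is an h-divisible $R$-module for every torsion-free $R$-module $L$. (c) $\operatorname{Hom}_R(Q,M)$ is an injective $Q$-module, and $\operatorname{Hom}_R(P,M)$ is an h-divisible $R$-module for every prime ideal $P$ of $R$. Moreover, if $R$ is local with maximal ideal $\mathfrak m$, if $R \to S$ is a local homomorphism of Noetherian local rings, and if $M$ is an Artinian $S$-module, regarded as an $R$-module through $R \to S$, then (a), (b), (c) are also equivalent to: (c$'$) $\operatorname{Hom}_R(Q,M)$ is an injective $Q$-module, and $\operatorname{Hom}_R(\mathfrak m,M)$ is an h-divisible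 $R$-module. -/

import Mathlib

universe u q v w s

/-- The `Q`-module `Hom_R(Q, M)`, for an `R`-algebra `Q` and an `R`-module `M`. This is the type of
`R`-linear maps `Q → M`; it has its own name because `Q` acts through the source, by
`(a • f) x = f (a * x)`, and not through the target. -/
def HomFrom (R : Type u) (Q : Type q) (M : Type v) [CommRing R] [CommRing Q] [Algebra R Q]
    [AddCommGroup M] [Module R M] : Type (max q v) :=
  Q →ₗ[R] M

namespace HomFrom

variable {R : Type u} {Q : Type q} {M : Type v} [CommRing R] [CommRing Q] [Algebra R Q]
  [AddCommGroup M] [Module R M]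

instance : AddCommGroup (HomFrom R Q M) :=
  inferInstanceAs (AddCommGroup (Q →ₗ[R] M))

instance : FunLike (HomFrom R Q M) Q M :=
  inferInstanceAs (FunLike (Q →ₗ[R] M) Q M)

instance : Module Q (HomFrom R Q M) where
  smul a f := LinearMap.comp (show Q →ₗ[R] M from f) (LinearMap.mulLeft R a)
  one_smul f := LinearMap.ext fun x => congrArg (show Q →ₗ[R] M from f) (one_mul x)
  mul_smul a b f := LinearMap.ext fun x => congrArg (show Q →ₗ[R] M from f)
    (show a * b * x = b * (a * x) by ring)
  smul_zero _ := rfl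
  smul_add _ _ _ := rfl
  add_smul a b f := LinearMap.ext fun x =>
    (congrArg (show Q →ₗ[R] M from f) (add_mul a b x)).trans (map_add (show Q →ₗ[R] M from f) _ _)
  zero_smul f := LinearMap.ext fun x =>
    (congrArg (show Q →ₗ[R] M from f) (zero_mul x)).trans (map_zero (show Q →ₗ[R] M from f))

theorem smul_apply (a : Q) (f : HomFrom R Q M) (x : Q) : (a • f) x = f (a * x) := rfl

end HomFrom

/-- An `R`-module `N` is h-divisible if it is an `R`-linear quotient of a free module over the total
quotient ring `Q` of `R`. (If `N` is a quotient of some free `Q`-module, then it is a quotient of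
one with a basis indexed by `N`, so it is no restriction that `ι` lies in the universe of `N`.) -/
def IsHDivisible (R : Type u) (Q : Type q) (N : Type v) [CommRing R] [CommRing Q] [Algebra R Q]
    [IsFractionRing R Q] [AddCommGroup N] [Module R N] : Prop :=
  ∃ (ι : Type v) (π : (ι →₀ Q) →ₗ[R] N), Function.Surjective π

/-! For (c) ⇒ (a), a map from an ideal `I` to `M` is first extended to `IQ`, then to `Q` by
injectivity of `Hom_R(Q, M)`. As `IQ/I` is torsion, the prime form of Baer's criterion for the first
extension tests only primes containing a non-zerodivisor (`Module.Baer.of_homFrom`), and there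
divisibility of `Hom_R(P, M)` suffices. For (c'), `exists_extension_of_forall_lt` descends from the
maximal ideal to these primes. For (a) ⇒ (b), maps extend along `L → Q ⊗ L`. -/

section Extension

variable {R : Type*} [CommRing R] {M : Type*} [AddCommGroup M] [Module R M]

/-- A partial linear map extends to an element `b` with value `c` when this is compatible with its
values on multiples of `b`. -/
theorem LinearPMap.exists_le_of_compatible {B : Type*} [AddCommGroup B] [Module R B]
    (f : B →ₗ.[R] M) (b : B) (c : M)
    (h : ∀ (r : R) (hr : r • b ∈ f.domain), f ⟨r • b, hr⟩ = r • c) :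
    ∃ g : B →ₗ.[R] M, f ≤ g ∧ g.domain = f.domain ⊔ Submodule.span R {b} := by
  have H : ∀ r : R, r • b = 0 → r • c = 0 := fun r hr => by
    rw [← h r (hr ▸ f.domain.zero_mem), ← f.map_zero]
    congr
  let k : B →ₗ.[R] M := LinearPMap.mkSpanSingleton' b c H
  have hc : ∀ (x : f.domain) (y : k.domain), (x : B) = y → f x = k y := by
    rintro ⟨x, hx⟩ ⟨y, hy⟩ (rfl : x = y)
    obtain ⟨r, rfl⟩ := Submodule.mem_span_singleton.mp hy
    exact (h r hx).trans (LinearPMap.mkSpanSingleton'_apply b c H r hy).symm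
  exact ⟨f.sup k hc, LinearPMap.left_le_sup _ _ _, rfl⟩

/-- A prime-ideal version of Baer's criterion, relative to an embedding `i : A → B`: only the primes
containing the annihilator of an element of the cokernel of `i` have to be tested. -/
theorem exists_extension_of_forall_isPrime [IsNoetherianRing R]
    {A B : Type*} [AddCommGroup A] [AddCommGroup B] [Module R A] [Module R B]
    (i : A →ₗ[R] B) (hi : Function.Injective i) (f : A →ₗ[R] M)
    (h : ∀ (b : B) (P : Ideal R), P.IsPrime → (∀ r : R, r • b ∈ LinearMap.range i → r ∈ P) →
      ∀ g : P →ₗ[R] M, ∃ c : M, ∀ p : P, g p = (p : R) • c) :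
    ∃ g : B →ₗ[R] M, ∀ a, g (i a) = f a := by
  have : Fact (Function.Injective i) := ⟨hi⟩
  let F := Module.Baer.extensionOfMax i f
  have htop : F.domain = ⊤ := by
    by_contra hne
    have : Nontrivial (B ⧸ F.domain) := Submodule.Quotient.nontrivial_iff.mpr hne
    -- An associated prime of `B ⧸ F.domain` is the exact obstruction to adjoining one `b` to the
    -- maximal extension `F`.
    obtain ⟨P, hP⟩ := associatedPrimes.nonempty R (B ⧸ F.domain)
    obtain ⟨hPp, x, hx⟩ := isAssociatedPrime_iff.mp hP
    obtain ⟨b, rfl⟩ := Submodule.mkQ_surjective _ x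
    have hmem : ∀ r : R, r ∈ P ↔ r • b ∈ F.domain := fun r => by
      rw [hx, Submodule.mem_colon_singleton, ← map_smul, Submodule.mem_bot,
        Submodule.mkQ_apply, Submodule.Quotient.mk_eq_zero]
    let g : P →ₗ[R] M := F.toLinearPMap.toFun ∘ₗ
      ((LinearMap.toSpanSingleton R B b ∘ₗ P.subtype).codRestrict F.domain
        fun p => (hmem p).mp p.2)
    obtain ⟨c, hc⟩ := h b P hPp (fun r hr => (hmem r).mpr (F.le hr)) g
    obtain ⟨G, hFG, hG⟩ := F.toLinearPMap.exists_le_of_compatible b c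
      fun r hr => hc ⟨r, (hmem r).mpr hr⟩
    let G' : Module.Baer.ExtensionOf i f :=
      { toLinearPMap := G
        le := F.le.trans hFG.1
        is_extension := fun m => (F.is_extension m).trans (hFG.2 rfl) }
    have hGF : G' = F := Module.Baer.extensionOfMax_is_max i f G' hFG
    have hb : b ∈ F.domain := by
      rw [← hGF]
      exact hG ▸ Submodule.mem_sup_right (Submodule.mem_span_singleton_self b)
    exact hPp.ne_top ((Ideal.eq_top_iff_one _).mpr ((hmem 1).mpr (by rwa [one_smul])))
  exact ⟨F.toLinearPMap.toFun ∘ₗ LinearMap.id.codRestrict F.domain fun x => htop ▸ trivial,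
    fun a => (F.is_extension a).symm⟩

/-- Every linear map from a prime ideal extends to the ring if all maps from strictly larger
primes do and multiplication by some `y` outside the prime is locally nilpotent on the target. -/
theorem exists_extension_of_forall_lt [IsNoetherianRing R] (P : Ideal R) [hP : P.IsPrime] {y : R}
    (hy : y ∉ P) (hnil : ∀ z : M, ∃ n : ℕ, y ^ n • z = 0)
    (h : ∀ P' : Ideal R, P'.IsPrime → P < P' →
      ∀ g : P' →ₗ[R] M, ∃ c : M, ∀ p : P', g p = (p : R) • c)
    (g : P →ₗ[R] M) : ∃ c : M, ∀ p : P, g p = (p : R) • c := by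
  -- If `y • g` is multiplication by `c`, then `y ↦ c` extends `g` to `P + (y)`: `r * y ∈ P` forces
  -- `r ∈ P`, so `g (r * y) = y • g r = r • c`. Primes containing `P + (y)` are strictly larger than
  -- `P`.
  have step : ∀ g : P →ₗ[R] M, (∃ c : M, ∀ p : P, (y • g) p = (p : R) • c) →
      ∃ c : M, ∀ p : P, g p = (p : R) • c := by
    rintro g ⟨c, hc⟩
    obtain ⟨G, hgG, hG⟩ := (LinearPMap.mk P g).exists_le_of_compatible y c fun r hr => by
      have hrP : r ∈ P := (hP.mem_or_mem hr).resolve_right hy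
      have : (⟨r • y, hr⟩ : P) = y • ⟨r, hrP⟩ := Subtype.ext (mul_comm r y)
      change g ⟨r • y, hr⟩ = _
      rw [this, map_smul]
      exact hc ⟨r, hrP⟩
    have hyG : y ∈ G.domain := hG ▸ Submodule.mem_sup_right (Submodule.mem_span_singleton_self y)
    obtain ⟨k, hk⟩ := exists_extension_of_forall_isPrime G.domain.subtype
      G.domain.injective_subtype G.toFun fun b P' hP' hb => by
        have hle : G.domain ≤ P' := fun r hr => hb r
          ⟨⟨r • b, by rw [smul_eq_mul, mul_comm]; exact G.domain.smul_mem b hr⟩, rfl⟩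
        exact h P' hP' (lt_of_le_of_ne (hgG.1.trans hle) fun e => hy (e ▸ hle hyG))
    refine ⟨k 1, fun p => ?_⟩
    rw [← map_smul, smul_eq_mul, mul_one]
    exact (hgG.2 (x := p) (y := ⟨p, hgG.1 p.2⟩) rfl).trans (hk ⟨p, hgG.1 p.2⟩).symm
  have step' : ∀ (n : ℕ) (g : P →ₗ[R] M), y ^ n • g = 0 →
      ∃ c : M, ∀ p : P, g p = (p : R) • c := by
    intro n
    induction n with
    | zero => exact fun g hg => ⟨0, fun p => by
        rw [smul_zero]; simpa using LinearMap.congr_fun hg p⟩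
    | succ n ih => exact fun g hg => step g (ih _ (by rwa [pow_succ, mul_smul] at hg))
  -- The kernels of `y ^ n • g` exhaust `P` and stabilize, so one power of `y` kills `g`.
  let K : ℕ →o Submodule R P :=
    ⟨fun n => LinearMap.ker (y ^ n • g), fun m n hmn x hx => by
      obtain ⟨k, rfl⟩ := Nat.exists_eq_add_of_le' hmn
      rw [LinearMap.mem_ker, LinearMap.smul_apply] at hx ⊢
      rw [pow_add, mul_smul, hx, smul_zero]⟩
  obtain ⟨n, hn⟩ := monotone_stabilizes_iff_noetherian.mpr (inferInstanceAs (IsNoetherian R P)) K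
  refine step' n g (LinearMap.ext fun x => ?_)
  obtain ⟨m, hm⟩ := hnil (g x)
  have hx : x ∈ K (max n m) := K.monotone (le_max_right n m) hm
  rw [← hn _ (le_max_left n m)] at hx
  exact hx

end Extension

/-- In an Artinian module over a local ring, every element is killed by a power of each element of
the maximal ideal. -/
theorem IsArtinian.exists_pow_smul_eq_zero {S M : Type*} [CommRing S] [IsLocalRing S]
    [AddCommGroup M] [Module S M] [IsArtinian S M] {s : S}
    (hs : s ∈ IsLocalRing.maximalIdeal S) (z : M) : ∃ n : ℕ, s ^ n • z = 0 := by
  obtain ⟨n, ⟨y, hy⟩, h⟩ := IsArtinian.exists_pow_succ_smul_dvd s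
    (⟨z, Submodule.mem_span_singleton_self z⟩ : Submodule.span S {z})
  obtain ⟨t, rfl⟩ := Submodule.mem_span_singleton.mp hy
  replace h : s ^ (n + 1) • t • z = s ^ n • z := congrArg Subtype.val h
  refine ⟨n, ?_⟩
  have hu : IsUnit (1 - s * t) :=
    (IsLocalRing.isUnit_or_isUnit_one_sub_self (s * t)).resolve_left
      ((IsLocalRing.mem_maximalIdeal _).mp (Ideal.mul_mem_right t _ hs))
  refine hu.smul_eq_zero.mp ?_
  rw [sub_smul, one_smul, sub_eq_zero, smul_smul, ← h, smul_smul]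
  congr 1
  ring

/-- Adjunction: evaluation at `1` turns `Q`-linear maps into `Hom_R(Q, M)` into `R`-linear maps into
`M`. -/
theorem Module.Baer.homFrom {R Q M : Type*} [CommRing R] [CommRing Q] [Algebra R Q]
    [AddCommGroup M] [Module R M] (h : Module.Baer R M) :
    Module.Baer Q (HomFrom R Q M) := by
  intro I g
  let ev : I →ₗ[R] M :=
    { toFun := fun x => g x 1
      map_add' := fun x y => by rw [map_add]; rfl
      map_smul' := fun r x => by
        have : r • x = algebraMap R Q r • x := (algebraMap_smul Q r x).symm
        rw [this, map_smul, HomFrom.smul_apply, mul_one, Algebra.algebraMap_eq_smul_one]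
        exact (show Q →ₗ[R] M from g x).map_smul r 1 }
  obtain ⟨φ, hφ⟩ := h.extension_property (I.subtype.restrictScalars R) I.injective_subtype ev
  refine ⟨LinearMap.toSpanSingleton Q (HomFrom R Q M) φ, fun x hx => DFunLike.ext _ _ fun q => ?_⟩
  have h1 : φ (q • x) = g (q • ⟨x, hx⟩) 1 := LinearMap.congr_fun hφ (q • ⟨x, hx⟩)
  rw [g.map_smul, HomFrom.smul_apply, mul_one] at h1
  exact (congrArg φ (mul_comm x q)).trans h1

section HDivisible

variable {R : Type*} [CommRing R] {Q : Type*} [CommRing Q] [Algebra R Q] [IsFractionRing R Q]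
  {M : Type*} [AddCommGroup M] [Module R M]

theorem isHDivisible_iff {N : Type*} [AddCommGroup N] [Module R N] :
    IsHDivisible R Q N ↔ ∀ n : N, ∃ ψ : Q →ₗ[R] N, ψ 1 = n := by
  constructor
  · rintro ⟨ι, π, hπ⟩ n
    obtain ⟨z, rfl⟩ := hπ n
    exact ⟨π ∘ₗ (LinearMap.toSpanSingleton Q (ι →₀ Q) z).restrictScalars R, by simp⟩
  · intro h
    choose ψ hψ using h
    exact ⟨N, Finsupp.lsum R ψ, fun n => ⟨Finsupp.single n 1, by simp [hψ]⟩⟩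

theorem IsHDivisible.of_linearEquiv {N N' : Type*} [AddCommGroup N] [Module R N] [AddCommGroup N']
    [Module R N'] (e : N ≃ₗ[R] N') (h : IsHDivisible R Q N) : IsHDivisible R Q N' :=
  isHDivisible_iff.mpr fun n =>
    have ⟨ψ, hψ⟩ := isHDivisible_iff.mp h (e.symm n)
    ⟨e.toLinearMap ∘ₗ ψ, by simp [hψ]⟩

theorem IsHDivisible.exists_smul_eq {N : Type*} [AddCommGroup N] [Module R N]
    (h : IsHDivisible R Q N) (x : nonZeroDivisors R) (n : N) : ∃ n', (x : R) • n' = n := by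
  obtain ⟨ψ, rfl⟩ := isHDivisible_iff.mp h n
  exact ⟨ψ (IsLocalization.mk' Q 1 x), by
    rw [← map_smul, Algebra.smul_def, IsLocalization.mk'_spec', map_one]⟩

/-- Writing `f = x • g` gives `f p = g (x * p) = p • g x`, so `c = g x` works. -/
theorem IsHDivisible.exists_extension {I : Ideal R} (h : IsHDivisible R Q (I →ₗ[R] M)) {x : R}
    (hx : x ∈ nonZeroDivisors R) (hxI : x ∈ I) (f : I →ₗ[R] M) :
    ∃ c : M, ∀ p : I, f p = (p : R) • c := by
  obtain ⟨g, rfl⟩ := h.exists_smul_eq ⟨x, hx⟩ f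
  refine ⟨g ⟨x, hxI⟩, fun p => ?_⟩
  rw [LinearMap.smul_apply, ← map_smul, ← map_smul]
  exact congrArg g (Subtype.ext (mul_comm _ _))

theorem Module.Baer.isHDivisible_hom (h : Module.Baer R M) {L : Type*} [AddCommGroup L]
    [Module R L] [Module.IsTorsionFree R L] : IsHDivisible R Q (L →ₗ[R] M) := by
  refine isHDivisible_iff.mpr fun f => ?_
  have hinj : Function.Injective (TensorProduct.mk R Q L 1) :=
    (IsLocalizedModule.injective_iff_isRegular (nonZeroDivisors R) _).mpr fun x =>
      Module.IsTorsionFree.isSMulRegular (isRegular_iff_mem_nonZeroDivisors.mpr x.2)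
  obtain ⟨F, hF⟩ := h.extension_property _ hinj f
  exact ⟨TensorProduct.curry F, hF⟩

/-- If `Hom_R(Q, M)` is injective over `Q`, then `M` is injective as soon as linear maps to `M`
from primes containing a non-zerodivisor extend. -/
theorem Module.Baer.of_homFrom [IsNoetherianRing R] (hQ : Module.Baer Q (HomFrom R Q M))
    (h : ∀ P : Ideal R, P.IsPrime → ∀ x ∈ nonZeroDivisors R, x ∈ P →
      ∀ g : P →ₗ[R] M, ∃ c : M, ∀ p : P, g p = (p : R) • c) : Module.Baer R M := by
  intro I f
  let J : Ideal Q := I.map (algebraMap R Q)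
  let i : I →ₗ[R] J.restrictScalars R := (Algebra.linearMap R Q ∘ₗ I.subtype).codRestrict _
    fun x => Ideal.mem_map_of_mem _ x.2
  have hi : Function.Injective i := fun x y hxy =>
    Subtype.ext (IsFractionRing.injective R Q (congrArg Subtype.val hxy))
  obtain ⟨φ, hφ⟩ := exists_extension_of_forall_isPrime i hi f fun b P hP hb => by
    obtain ⟨⟨a, s⟩, has⟩ :=
      (IsLocalization.mem_map_algebraMap_iff (nonZeroDivisors R) Q).mp b.2
    refine h P hP s s.2 (hb s ⟨a, Subtype.ext ?_⟩)
    rw [mul_comm, ← Algebra.smul_def] at has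
    exact has.symm
  -- The adjoint of `φ`, sending `b` to `q ↦ φ (q * b)`.
  let G : J →ₗ[Q] HomFrom R Q M :=
    { toFun := fun b => φ ∘ₗ (LinearMap.toSpanSingleton Q J b).restrictScalars R
      map_add' := fun b b' => LinearMap.ext fun q => by
        change φ (q • (b + b')) = φ (q • b) + φ (q • b')
        rw [smul_add]; exact map_add φ _ _
      map_smul' := fun a b => LinearMap.ext fun q => by
        change φ (q • a • b) = φ ((a * q) • b)
        rw [smul_smul, mul_comm] }
  obtain ⟨G', hG'⟩ := hQ J G
  refine ⟨(show Q →ₗ[R] M from G' 1) ∘ₗ Algebra.linearMap R Q, fun x hx => ?_⟩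
  have h1 : G' (algebraMap R Q x) 1 = φ (i ⟨x, hx⟩) :=
    (DFunLike.congr_fun (hG' _ (Ideal.mem_map_of_mem _ hx)) 1).trans
      (congrArg φ (Subtype.ext (one_mul _)))
  have h2 : G' (algebraMap R Q x) 1 = G' 1 (algebraMap R Q x) := by
    conv_lhs => rw [← mul_one (algebraMap R Q x), ← smul_eq_mul, map_smul, HomFrom.smul_apply,
      mul_one]
  rw [hφ, h2] at h1
  exact h1

end HDivisible

/-- Noetherian induction from the maximal ideal downward: any `y` in it but outside `P` is locally
nilpotent on `M`, since its image in `S` is a nonunit. -/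
theorem IsLocalRing.exists_extension_of_isHDivisible {R : Type*} [CommRing R] [IsNoetherianRing R]
    [IsLocalRing R] {Q : Type*} [CommRing Q] [Algebra R Q] [IsFractionRing R Q] {M : Type*}
    [AddCommGroup M] [Module R M] (S : Type*) [CommRing S] [IsLocalRing S] [Algebra R S]
    [IsLocalHom (algebraMap R S)] [Module S M] [IsScalarTower R S M] [IsArtinian S M]
    (h : IsHDivisible R Q (IsLocalRing.maximalIdeal R →ₗ[R] M)) (P : Ideal R) (hP : P.IsPrime)
    (x : R) (hx : x ∈ nonZeroDivisors R) (hxP : x ∈ P) (g : P →ₗ[R] M) :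
    ∃ c : M, ∀ p : P, g p = (p : R) • c := by
  induction P using WellFoundedGT.induction with
  | ind P ih =>
    obtain rfl | hlt := (IsLocalRing.le_maximalIdeal hP.ne_top).eq_or_lt
    · exact h.exists_extension hx hxP g
    · obtain ⟨y, hym, hyP⟩ := SetLike.exists_of_lt hlt
      refine exists_extension_of_forall_lt P hyP (fun z => ?_)
        (fun P' hP' hlt' => ih P' hlt' hP' (hlt'.le hxP)) g
      obtain ⟨n, hn⟩ := IsArtinian.exists_pow_smul_eq_zero (s := algebraMap R S y)
        ((IsLocalRing.mem_maximalIdeal _).mpr fun hu =>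
          (IsLocalRing.mem_maximalIdeal y).mp hym (isUnit_of_map_unit _ y hu)) z
      exact ⟨n, by rwa [← map_pow, algebraMap_smul] at hn⟩

theorem theorem5p2 (R : Type u) [CommRing R] [IsNoetherianRing R]
    (Q : Type q) [CommRing Q] [Algebra R Q] [IsFractionRing R Q]
    (M : Type v) [AddCommGroup M] [Module R M] [Small.{v} R] [Small.{w} R] :
    List.TFAE [
      Module.Injective R M,
      Module.Injective Q (HomFrom R Q M) ∧
        ∀ (L : Type w) [AddCommGroup L] [Module R L],
          Module.IsTorsionFree R L → IsHDivisible R Q (L →ₗ[R] M),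
      Module.Injective Q (HomFrom R Q M) ∧
        ∀ P : Ideal R, P.IsPrime → IsHDivisible R Q (P →ₗ[R] M)] ∧
    ∀ (S : Type s) [IsLocalRing R] [CommRing S] [IsLocalRing S] [IsNoetherianRing S]
      [Algebra R S] [IsLocalHom (algebraMap R S)]
      [Module S M] [IsScalarTower R S M] [IsArtinian S M],
      List.TFAE [
        Module.Injective R M,
        Module.Injective Q (HomFrom R Q M) ∧
          ∀ (L : Type w) [AddCommGroup L] [Module R L],
            Module.IsTorsionFree R L → IsHDivisible R Q (L →ₗ[R] M),
        Module.Injective Q (HomFrom R Q M) ∧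
          ∀ P : Ideal R, P.IsPrime → IsHDivisible R Q (P →ₗ[R] M),
        Module.Injective Q (HomFrom R Q M) ∧
          IsHDivisible R Q (IsLocalRing.maximalIdeal R →ₗ[R] M)] := by
  have ab : Module.Injective R M → Module.Injective Q (HomFrom R Q M) ∧
      ∀ (L : Type w) [AddCommGroup L] [Module R L],
        Module.IsTorsionFree R L → IsHDivisible R Q (L →ₗ[R] M) := fun h =>
    ⟨(Module.Baer.of_injective h).homFrom.injective,
      fun _ _ _ _ => (Module.Baer.of_injective h).isHDivisible_hom⟩
  have bc : (∀ (L : Type w) [AddCommGroup L] [Module R L],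
        Module.IsTorsionFree R L → IsHDivisible R Q (L →ₗ[R] M)) →
      ∀ P : Ideal R, P.IsPrime → IsHDivisible R Q (P →ₗ[R] M) := fun h P _ => by
    let e := Shrink.linearEquiv.{w} R P
    exact (h (Shrink.{w} P) (e.injective.moduleIsTorsionFree e e.map_smul)).of_linearEquiv
      (LinearEquiv.congrLeft M R e)
  have ca : (Module.Injective Q (HomFrom R Q M) ∧
      ∀ P : Ideal R, P.IsPrime → IsHDivisible R Q (P →ₗ[R] M)) → Module.Injective R M := fun h =>
    (Module.Baer.of_homFrom (Module.Baer.of_injective h.1)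
      fun P hP _ hx hxP => (h.2 P hP).exists_extension hx hxP).injective
  refine ⟨?_, ?_⟩
  · tfae_have 1 → 2 := ab
    tfae_have 2 → 3 := fun h => ⟨h.1, bc h.2⟩
    tfae_have 3 → 1 := ca
    tfae_finish
  · intro S _ _ _ _ _ _ _ _ _
    tfae_have 1 → 2 := ab
    tfae_have 2 → 3 := fun h => ⟨h.1, bc h.2⟩
    tfae_have 3 → 4 := fun h => ⟨h.1, h.2 _ inferInstance⟩
    tfae_have 4 → 1 := fun h =>
      (Module.Baer.of_homFrom (Module.Baer.of_injective h.1)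
        (IsLocalRing.exists_extension_of_isHDivisible S h.2)).injective
    tfae_finish
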